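/- Let $T\ge 0$ and let $(v_t)_{0\le t\le T}$ be an $\mathbb{R}^n$-valued Markov process on a probability space (possibly time-inhomogeneous, with respect to its own history). Let $M:\mathbb{R}^n\times[0,T]\to\mathbb{R}_{\ge 0}$ be measurable in its first argument and a continuous-time affine martingale of $(v_t)$ with coefficients $a_t,b_t\in\mathbb{R}$, where $a,b$ are Lebesgue integrable on $[0,T]$: every $M(v_t,t)$ is integrable, and for every $t\in[0,T)$ $$\frac{\mathbb{E}[M(v_{t+h},t+h)\mid v_t]-M(v_t,t)}{h}\le a_tM(v_t,t)+b_t\qquad\text{as } h\to 0^+,$$ meaning that the positive part of (left side minus right side) tends to $0$ in $L^1$ as $h\to0^+$. Assume that almost every path $t\mapsto M(v_t,t)$ is right-continuous on $[0,T]$ and that for each fixed $t$ it is almost surely left-continuous at $t$ (for instance, that almost all paths are continuous). Put $$\psi_t=e^{\int_t^T a_\tau\,d\tau},\qquad \widetilde M(x,t)=M(x,t)\psi_t+\int_t^T b_\tau\psi_\tau\,d\tau .$$ Then for every $\overline M>0$ the event $\{\widetilde M(v_t,t)\le\overline M\ \text{for all } t\in[0,T]\}$ is measurable for the completed probability measure,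 and $$\mathbb{P}\big(\widetilde M(v_t,t)\le\overline M\ \ \text{for all } t\in[0,T]\big)\ \ge\ 1-\frac{\mathbb{E}[M(v_0,0)]\,\psi_0+\int_0^T b_\tau\psi_\tau\,d\tau}{\overline M},$$ where $\mathbb{E}[M(v_0,0)]=M(v_0,0)$ if $v_0$ is deterministic. -/

import Mathlib

open MeasureTheory Filter Topology

noncomputable section

namespace CTAffine

variable {Ω : Type*} [mΩ : MeasurableSpace Ω] {n : ℕ}

/-- The σ-algebra `σ(v_t)` generated by the state at time `t`. -/
abbrev present (v : ℝ → Ω → EuclideanSpace ℝ (Fin n)) (t : ℝ) : MeasurableSpace Ω :=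
  MeasurableSpace.comap (v t) inferInstance

/-- The σ-algebra `σ(v_r : 0 ≤ r ≤ t)` generated by the history up to time `t`. -/
abbrev past (v : ℝ → Ω → EuclideanSpace ℝ (Fin n)) (t : ℝ) : MeasurableSpace Ω :=
  ⨆ r ∈ Set.Icc (0 : ℝ) t, present v r

/-- `(v_t)`, `0 ≤ t ≤ T`, is a (possibly time-inhomogeneous) Markov process in `ℝⁿ`: each `v_t` is
a random vector, and `P(v_t ∈ A | v_r, r ≤ s) = P(v_t ∈ A | v_s)` a.s. for all `s ≤ t` and all
Borel sets `A`. -/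
structure IsMarkovProcess (μ : Measure Ω) (T : ℝ) (v : ℝ → Ω → EuclideanSpace ℝ (Fin n)) :
    Prop where
  measurable : ∀ t ∈ Set.Icc (0 : ℝ) T, Measurable (v t)
  markov : ∀ s t : ℝ, 0 ≤ s → s ≤ t → t ≤ T →
    ∀ A : Set (EuclideanSpace ℝ (Fin n)), MeasurableSet A →
      μ[(v t ⁻¹' A).indicator (fun _ => (1 : ℝ)) | past v s]
        =ᵐ[μ] μ[(v t ⁻¹' A).indicator (fun _ => (1 : ℝ)) | present v s]

/-- Regularity in time of a real process `(Y_t)`, `0 ≤ t ≤ T`: almost every path is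
right-continuous, and no time is a fixed time of discontinuity, that is, for each given `t`, almost
every path is left-continuous at `t`. Every process with a.s. continuous paths qualifies. -/
structure IsRegularProcess (μ : Measure Ω) (T : ℝ) (Y : ℝ → Ω → ℝ) : Prop where
  right_cont : ∀ᵐ ω ∂μ, ∀ t ∈ Set.Icc (0 : ℝ) T,
    ContinuousWithinAt (fun s => Y s ω) (Set.Icc t T) t
  left_cont : ∀ t ∈ Set.Icc (0 : ℝ) T, ∀ᵐ ω ∂μ,
    ContinuousWithinAt (fun s => Y s ω) (Set.Icc 0 t) t

/-- `M` is a continuous-time affine martingale of `(v_t)` over `[0, T]` with coefficients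
`a_t, b_t`: `M ≥ 0`, `M(v_t, t)` is an integrable random variable, and for each `t ∈ [0, T)` the
inequality
`(E[M(v_{t+h}, t+h) | v_t] - M(v_t, t)) / h ≤ a_t M(v_t, t) + b_t`
holds in the limit `h → 0+`, in the sense that the mean of the amount by which it is violated
tends to zero. -/
structure IsAffineMartingale (μ : Measure Ω) (T : ℝ) (v : ℝ → Ω → EuclideanSpace ℝ (Fin n))
    (M : EuclideanSpace ℝ (Fin n) → ℝ → ℝ) (a b : ℝ → ℝ) : Prop where
  measurable : ∀ t ∈ Set.Icc (0 : ℝ) T, Measurable (fun x => M x t)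
  nonneg : ∀ t ∈ Set.Icc (0 : ℝ) T, ∀ x, 0 ≤ M x t
  integrable : ∀ t ∈ Set.Icc (0 : ℝ) T, Integrable (fun ω => M (v t ω) t) μ
  drift_le : ∀ t ∈ Set.Ico (0 : ℝ) T,
    Tendsto
      (fun h : ℝ => ∫ ω,
        max (((μ[fun ω' => M (v (t + h) ω') (t + h) | present v t]) ω - M (v t ω) t) / h
          - (a t * M (v t ω) t + b t)) 0 ∂μ)
      (𝓝[>] 0) (𝓝 0)

/-- `ψ_t = exp (∫_t^T a_τ dτ)`. -/
def psi (a : ℝ → ℝ) (T t : ℝ) : ℝ := Real.exp (∫ τ in t..T, a τ)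

/-- `M̃(x, t) = M(x, t) ψ_t + ∫_t^T b_τ ψ_τ dτ`. -/
def Mtilde (M : EuclideanSpace ℝ (Fin n) → ℝ → ℝ) (a b : ℝ → ℝ) (T : ℝ)
    (x : EuclideanSpace ℝ (Fin n)) (t : ℝ) : ℝ :=
  M x t * psi a T t + ∫ τ in t..T, b τ * psi a T τ

/-- The sublevel set `𝒱_t = {x : M̃(x, t) ≤ M̄}`. -/
def sublevel (M : EuclideanSpace ℝ (Fin n) → ℝ → ℝ) (a b : ℝ → ℝ) (T Mbar t : ℝ) :
    Set (EuclideanSpace ℝ (Fin n)) :=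
  {x | Mtilde M a b T x t ≤ Mbar}

end CTAffine

end

/-!
The process `M̃(v_t, t)` is a supermartingale for the history of `v`, and its last value
`M̃(v_T, T) = M(v_T, T)` is nonnegative, so the bound is Doob's maximal inequality.

The supermartingale property is the point that needs care, since the drift condition is
infinitesimal and `a`, `b` are only integrable. Fix `s` and an event `A` of the past of `s`, and let
`φ(r)` be the integral of `M(v_r, r)` over `A`. By the Markov property, conditioning on the present
may be replaced by conditioning on the past, so the drift condition says that the right upper Dini
derivative of `φ` is at most `a φ + b P(A)` at *every* time
(`IsAffineMartingale.setIntegral_rightDini_le`). The absence of fixed discontinuities makes `φ`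
lower semicontinuous from the left (`IsAffineMartingale.eventually_lt_setIntegral`). These two facts
suffice for Grönwall's inequality (`le_of_rightDini_le_affine`): by the Vitali–Carathéodory theorem
`a` has lower semicontinuous majorants `g` with almost the same integral; `φ exp (-∫ g)` then has
right upper Dini derivative at most `b P(A) exp (-∫ g)` everywhere, because `φ ≥ 0`, and a second
use of Vitali–Carathéodory, in `sub_le_integral_of_rightDini_le`, integrates this bound. Letting
`∫ g` tend to `∫ a` gives `IsAffineMartingale.setIntegral_Mtilde_le`.

The maximal inequality is proved along finitely many times and applied to dyadic grids. By
right-continuity of the paths, the event of exceeding `M̄` at some time agrees almost surely with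
the increasing union of the events of exceeding it on a grid, which gives both measurability and
the bound.
-/

namespace CTAffine

/-! ### Functions with a bounded right upper Dini derivative -/

/-- A primitive of a lower semicontinuous function increases to the right of `u` at least as fast
as the value at `u` dictates. -/
theorem eventually_mul_le_integral_of_lowerSemicontinuous {g : ℝ → EReal} {s t u y : ℝ}
    (hg : LowerSemicontinuous g)
    (hint : IntegrableOn (fun x => (g x).toReal) (Set.Icc s t))
    (htop : ∀ᵐ x ∂volume.restrict (Set.Icc s t), g x < ⊤)
    (hu : u ∈ Set.Ico s t) (hy : (y : EReal) < g u) :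
    ∀ᶠ r in 𝓝[>] u, (r - u) * y ≤ ∫ w in u..r, (g w).toReal := by
  obtain ⟨m, m', ⟨hm, hm'⟩, H⟩ :=
    mem_nhds_iff_exists_Ioo_subset.1 (hg.lowerSemicontinuousAt _ _ hy)
  filter_upwards [Ioo_mem_nhdsGT (lt_min hm' hu.2)] with r hr
  have I : Set.Icc u r ⊆ Set.Icc s t :=
    Set.Icc_subset_Icc hu.1 (hr.2.le.trans (min_le_right _ _))
  calc
    (r - u) * y = ∫ _ in Set.Icc u r, y := by
      simp only [MeasureTheory.integral_const, MeasurableSet.univ, measureReal_restrict_apply,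
        Set.univ_inter, hr.1.le, Real.volume_real_Icc_of_le, smul_eq_mul]
    _ ≤ ∫ w in u..r, (g w).toReal := by
      rw [intervalIntegral.integral_of_le hr.1.le, ← integral_Icc_eq_integral_Ioc]
      refine setIntegral_mono_ae_restrict (by simp) (hint.mono_set I) ?_
      filter_upwards [ae_mono (Measure.restrict_mono I le_rfl) htop,
        ae_restrict_mem measurableSet_Icc] with x hx hxI
      have hxy : (y : EReal) < g x :=
        H ⟨hm.trans_le hxI.1, hxI.2.trans_lt (hr.2.trans_le (min_le_left _ _))⟩
      apply EReal.coe_le_coe_iff.1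
      rw [EReal.coe_toReal hx.ne (bot_lt_iff_ne_bot.1 ((EReal.bot_lt_coe y).trans hxy))]
      exact hxy.le

/-- Induction along a real interval: a property that holds at the left end point, passes to limits
from the left and spreads to the right holds at the right end point. -/
theorem real_induction {p : ℝ → Prop} {s t : ℝ} (hst : s ≤ t) (h0 : p s)
    (hleft : ∀ u ∈ Set.Ioc s t, (∀ r ∈ Set.Ico s u, p r) → p u)
    (hright : ∀ u ∈ Set.Ico s t, p u → ∀ᶠ r in 𝓝[>] u, p r) : p t := by
  set S : Set ℝ := {u | u ∈ Set.Icc s t ∧ ∀ r ∈ Set.Icc s u, p r} with hS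
  have hsS : s ∈ S := ⟨Set.left_mem_Icc.2 hst, fun r hr => by rwa [le_antisymm hr.2 hr.1]⟩
  have hbdd : BddAbove S := ⟨t, fun u hu => hu.1.2⟩
  have hcs : s ≤ sSup S := le_csSup hbdd hsS
  have hct : sSup S ≤ t := csSup_le ⟨s, hsS⟩ fun u hu => hu.1.2
  have hlt : ∀ r ∈ Set.Ico s (sSup S), p r := by
    intro r hr
    obtain ⟨u, hu, hru⟩ := exists_lt_of_lt_csSup ⟨s, hsS⟩ hr.2
    exact hu.2 r ⟨hr.1, hru.le⟩
  have hpc : p (sSup S) := by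
    rcases hcs.eq_or_lt with h | h
    · rwa [← h]
    · exact hleft _ ⟨h, hct⟩ hlt
  rcases hct.eq_or_lt with h | h
  · rwa [← h]
  · obtain ⟨m, hm, hmp⟩ := mem_nhdsGT_iff_exists_Ioc_subset.1 (hright _ ⟨hcs, h⟩ hpc)
    have hmem : min m t ∈ S := by
      refine ⟨⟨hcs.trans (le_min hm.le h.le), min_le_right _ _⟩, fun r hr => ?_⟩
      rcases lt_trichotomy r (sSup S) with h1 | h1 | h1
      · exact hlt r ⟨hr.1, h1⟩
      · rwa [h1]
      · exact hmp ⟨h1, hr.2.trans (min_le_left _ _)⟩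
    exact absurd (le_csSup hbdd hmem) (not_le.2 (lt_min hm h))

/-- A function whose right upper Dini derivative is everywhere at most an integrable function `f`,
and which does not jump upwards from the left, grows by at most the integral of `f`. -/
theorem sub_le_integral_of_rightDini_le {θ f : ℝ → ℝ} {s t : ℝ} (hst : s ≤ t)
    (hf : IntegrableOn f (Set.Icc s t))
    (hright : ∀ u ∈ Set.Ico s t, ∀ c, f u < c → ∀ᶠ r in 𝓝[>] u, θ r - θ u ≤ c * (r - u))
    (hleft : ∀ u ∈ Set.Ioc s t, ∀ c, c < θ u → ∀ᶠ r in 𝓝[<] u, c < θ r) :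
    θ t - θ s ≤ ∫ u in s..t, f u := by
  refine le_of_forall_pos_le_add fun ε hε => ?_
  obtain ⟨g, hfg, hgc, hgi, hgt, hgε⟩ := exists_lt_lowerSemicontinuous_integral_lt f hf hε
  have hii : ∀ x y, s ≤ x → x ≤ y → y ≤ t →
      IntervalIntegrable (fun w => (g w).toReal) volume x y := fun x y hx hxy hy => by
    rw [intervalIntegrable_iff_integrableOn_Ioc_of_le hxy]
    exact IntegrableOn.mono_set hgi (Set.Ioc_subset_Icc_self.trans (Set.Icc_subset_Icc hx hy))
  have hcont : ContinuousOn (fun r => ∫ w in s..r, (g w).toReal) (Set.Icc s t) := by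
    have := intervalIntegral.continuousOn_primitive_interval (μ := volume)
      (f := fun w => (g w).toReal) (a := s) (b := t) (by rwa [Set.uIcc_of_le hst])
    rwa [Set.uIcc_of_le hst] at this
  have main : θ t - θ s ≤ ∫ w in s..t, (g w).toReal := by
    refine real_induction (p := fun r => θ r - θ s ≤ ∫ w in s..r, (g w).toReal) hst (by simp)
      (fun u hu hlt => ?_) (fun u hu hpu => ?_)
    · refine le_of_forall_lt fun c hc => ?_
      obtain ⟨d, hcd, hd⟩ := exists_between hc
      have hlim : Tendsto (fun r => ∫ w in s..r, (g w).toReal) (𝓝[<] u)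
          (𝓝 (∫ w in s..u, (g w).toReal)) := by
        refine ((hcont u ⟨hu.1.le, hu.2⟩).mono_left ?_)
        rw [← nhdsWithin_Ioo_eq_nhdsLT hu.1]
        exact nhdsWithin_mono _ fun r hr => ⟨hr.1.le, hr.2.le.trans hu.2⟩
      refine hcd.trans_le (ge_of_tendsto hlim ?_)
      filter_upwards [hleft u hu (d + θ s) (by linarith), Ioo_mem_nhdsLT hu.1] with r hr hrI
      have := hlt r ⟨hrI.1.le, hrI.2⟩
      linarith
    · obtain ⟨y, hy1, hy2⟩ := EReal.lt_iff_exists_real_btwn.1 (hfg u)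
      filter_upwards [hright u hu y (EReal.coe_lt_coe_iff.1 hy1),
        eventually_mul_le_integral_of_lowerSemicontinuous hgc hgi hgt hu hy2,
        Ioo_mem_nhdsGT hu.2] with r h1 h2 hr
      rw [← intervalIntegral.integral_add_adjacent_intervals (hii s u le_rfl hu.1 hu.2.le)
        (hii u r hu.1 hr.1.le hr.2.le)]
      linarith
  rw [intervalIntegral.integral_of_le hst, ← integral_Icc_eq_integral_Ioc] at main ⊢
  linarith

/-- A Grönwall inequality with merely integrable coefficients: it suffices that the differential
inequality `φ' ≤ a φ + b` holds everywhere for the right upper Dini derivative. -/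
theorem le_of_rightDini_le_affine {φ a b : ℝ → ℝ} {s t : ℝ} (hst : s ≤ t)
    (ha : IntegrableOn a (Set.Icc s t)) (hb : IntegrableOn b (Set.Icc s t))
    (hφ : ∀ u ∈ Set.Icc s t, 0 ≤ φ u)
    (hright : ∀ u ∈ Set.Ico s t, ∀ c, a u * φ u + b u < c →
      ∀ᶠ r in 𝓝[>] u, φ r - φ u ≤ c * (r - u))
    (hleft : ∀ u ∈ Set.Ioc s t, ∀ c, c < φ u → ∀ᶠ r in 𝓝[<] u, c < φ r) :
    φ t * Real.exp (-∫ w in s..t, a w)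
      ≤ φ s + ∫ u in s..t, b u * Real.exp (-∫ w in s..u, a w) := by
  have hcontP : ∀ f : ℝ → ℝ, IntegrableOn f (Set.Icc s t) →
      ContinuousOn (fun r => Real.exp (-∫ w in s..r, f w)) (Set.Icc s t) := fun f hf => by
    have := intervalIntegral.continuousOn_primitive_interval (μ := volume)
      (f := f) (a := s) (b := t) (by rwa [Set.uIcc_of_le hst])
    rw [Set.uIcc_of_le hst] at this
    exact Real.continuous_exp.comp_continuousOn this.neg
  have hii : ∀ f : ℝ → ℝ, IntegrableOn f (Set.Icc s t) → ∀ x y, s ≤ x → x ≤ y → y ≤ t →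
      IntervalIntegrable f volume x y := fun f hf x y hx hxy hy => by
    rw [intervalIntegrable_iff_integrableOn_Ioc_of_le hxy]
    exact hf.mono_set (Set.Ioc_subset_Icc_self.trans (Set.Icc_subset_Icc hx hy))
  -- At points where the primitive of `a` is not differentiable the weight `exp (-∫ a)` gives no
  -- control on Dini derivatives, so it is replaced by `exp (-∫ g)` with `g > a` lower
  -- semicontinuous.
  have step : ∀ g : ℝ → EReal, (∀ x, (a x : EReal) < g x) → LowerSemicontinuous g →
      IntegrableOn (fun x => (g x).toReal) (Set.Icc s t) →
      (∀ᵐ x ∂volume.restrict (Set.Icc s t), g x < ⊤) →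
      φ t * Real.exp (-∫ w in s..t, (g w).toReal)
        ≤ φ s + ∫ u in s..t, b u * Real.exp (-∫ w in s..u, (g w).toReal) := by
    intro g hag hgc hgi hgt
    have hB := hcontP _ hgi
    have hBi := hii _ hgi
    set B : ℝ → ℝ := fun r => Real.exp (-∫ w in s..r, (g w).toReal) with hBdef
    have hBpos : ∀ r, 0 < B r := fun r => Real.exp_pos _
    have key := sub_le_integral_of_rightDini_le (θ := fun r => φ r * B r)
      (f := fun r => b r * B r) hst (hb.mul_continuousOn hB isCompact_Icc) ?_ ?_
    · have hBs : B s = 1 := by simp [hBdef]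
      simp only [hBs, mul_one] at key
      linarith
    · intro u hu c hc
      obtain ⟨d, hbd, hdc⟩ : ∃ d, b u < d ∧ d * B u < c := by
        obtain ⟨d, hd1, hd2⟩ := exists_between ((lt_div_iff₀ (hBpos u)).2 hc)
        exact ⟨d, hd1, (lt_div_iff₀ (hBpos u)).1 hd2⟩
      have hBright : Tendsto (fun r => d * B r) (𝓝[>] u) (𝓝 (d * B u)) := by
        refine Tendsto.const_mul _ ((hB u ⟨hu.1, hu.2.le⟩).mono_left ?_)
        rw [← nhdsWithin_Ioo_eq_nhdsGT hu.2]
        exact nhdsWithin_mono _ fun r hr => ⟨hu.1.trans hr.1.le, hr.2.le⟩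
      filter_upwards [hright u hu (a u * φ u + d) (by linarith),
        eventually_mul_le_integral_of_lowerSemicontinuous hgc hgi hgt hu (hag u),
        hBright.eventually (gt_mem_nhds hdc), Ioo_mem_nhdsGT hu.2] with r h1 h2 h3 hr
      -- `1 + a h ≤ exp (a h) ≤ B u / B r`; since `φ u ≥ 0`, the term `a φ` is absorbed.
      have hBr : (1 + a u * (r - u)) * B r ≤ B u := by
        have e : B r = B u * Real.exp (-∫ w in u..r, (g w).toReal) := by
          rw [hBdef, ← Real.exp_add]
          simp only
          rw [← intervalIntegral.integral_add_adjacent_intervals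
            (hBi s u le_rfl hu.1 hu.2.le) (hBi u r hu.1 hr.1.le hr.2.le)]
          congr 1; ring
        calc (1 + a u * (r - u)) * B r
            ≤ Real.exp (∫ w in u..r, (g w).toReal) * B r := by
              refine mul_le_mul_of_nonneg_right ?_ (hBpos r).le
              have := Real.add_one_le_exp (∫ w in u..r, (g w).toReal)
              linarith
          _ = B u := by
              rw [e, mul_left_comm, ← Real.exp_add]; simp
      have h0 := hφ u ⟨hu.1, hu.2.le⟩
      have hh : 0 < r - u := sub_pos.2 hr.1
      calc φ r * B r - φ u * B u
          ≤ (φ u + (a u * φ u + d) * (r - u)) * B r - φ u * B u := by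
            have := mul_le_mul_of_nonneg_right (sub_le_iff_le_add'.1 h1) (hBpos r).le
            linarith
        _ = φ u * ((1 + a u * (r - u)) * B r) + d * B r * (r - u) - φ u * B u := by ring
        _ ≤ φ u * B u + c * (r - u) - φ u * B u := by
            have := mul_le_mul_of_nonneg_left hBr h0
            have := mul_le_mul_of_nonneg_right h3.le hh.le
            linarith
        _ = c * (r - u) := by ring
    · intro u hu c hc
      obtain ⟨d, hd1, hd2⟩ := exists_between ((div_lt_iff₀ (hBpos u)).2 hc)
      have hBleft : Tendsto (fun r => d * B r) (𝓝[<] u) (𝓝 (d * B u)) := by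
        refine Tendsto.const_mul _ ((hB u ⟨hu.1.le, hu.2⟩).mono_left ?_)
        rw [← nhdsWithin_Ioo_eq_nhdsLT hu.1]
        exact nhdsWithin_mono _ fun r hr => ⟨hr.1.le, hr.2.le.trans hu.2⟩
      filter_upwards [hleft u hu d hd2,
        hBleft.eventually (lt_mem_nhds ((div_lt_iff₀ (hBpos u)).1 hd1))] with r h1 h2
      exact h2.trans (mul_lt_mul_of_pos_right h1 (hBpos r))
  choose g hag hgc hgi hgt hgε using fun k : ℕ =>
    exists_lt_lowerSemicontinuous_integral_lt a ha (Nat.one_div_pos_of_nat (α := ℝ) (n := k))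
  have hle : ∀ k, ∀ᵐ x ∂volume.restrict (Set.Icc s t), a x ≤ (g k x).toReal := fun k => by
    filter_upwards [hgt k] with x hx
    rw [← EReal.coe_le_coe_iff,
      EReal.coe_toReal hx.ne (bot_lt_iff_ne_bot.1 ((EReal.bot_lt_coe _).trans (hag k x)))]
    exact (hag k x).le
  have hlo : ∀ k, ∀ r ∈ Set.Icc s t, ∫ w in s..r, a w ≤ ∫ w in s..r, (g k w).toReal := by
    intro k r hr
    rw [intervalIntegral.integral_of_le hr.1, intervalIntegral.integral_of_le hr.1]
    have hsub : Set.Ioc s r ⊆ Set.Icc s t :=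
      Set.Ioc_subset_Icc_self.trans (Set.Icc_subset_Icc le_rfl hr.2)
    exact setIntegral_mono_ae_restrict (ha.mono_set hsub) (IntegrableOn.mono_set (hgi k) hsub)
      (ae_mono (Measure.restrict_mono hsub le_rfl) (hle k))
  have hhi : ∀ k, ∀ r ∈ Set.Icc s t,
      ∫ w in s..r, (g k w).toReal ≤ (∫ w in s..r, a w) + 1 / ((k : ℝ) + 1) := by
    intro k r hr
    have h1 : ∫ w in r..t, a w ≤ ∫ w in r..t, (g k w).toReal := by
      rw [intervalIntegral.integral_of_le hr.2, intervalIntegral.integral_of_le hr.2]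
      have hsub : Set.Ioc r t ⊆ Set.Icc s t :=
        Set.Ioc_subset_Icc_self.trans (Set.Icc_subset_Icc hr.1 le_rfl)
      exact setIntegral_mono_ae_restrict (ha.mono_set hsub) (IntegrableOn.mono_set (hgi k) hsub)
        (ae_mono (Measure.restrict_mono hsub le_rfl) (hle k))
    have h2 := hgε k
    rw [integral_Icc_eq_integral_Ioc, integral_Icc_eq_integral_Ioc,
      ← intervalIntegral.integral_of_le hst, ← intervalIntegral.integral_of_le hst,
      ← intervalIntegral.integral_add_adjacent_intervals
        (hii _ (hgi k) s r le_rfl hr.1 hr.2) (hii _ (hgi k) r t hr.1 hr.2 le_rfl),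
      ← intervalIntegral.integral_add_adjacent_intervals
        (hii _ ha s r le_rfl hr.1 hr.2) (hii _ ha r t hr.1 hr.2 le_rfl)] at h2
    linarith
  have hlim : ∀ r ∈ Set.Icc s t, Tendsto (fun k => Real.exp (-∫ w in s..r, (g k w).toReal)) atTop
      (𝓝 (Real.exp (-∫ w in s..r, a w))) := by
    intro r hr
    refine (Real.continuous_exp.tendsto _).comp (Tendsto.neg ?_)
    refine tendsto_of_tendsto_of_tendsto_of_le_of_le tendsto_const_nhds ?_
      (fun k => hlo k r hr) (fun k => hhi k r hr)
    simpa using tendsto_const_nhds.add (tendsto_one_div_add_atTop_nhds_zero_nat (𝕜 := ℝ))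
  refine le_of_tendsto_of_tendsto' ((hlim t (Set.right_mem_Icc.2 hst)).const_mul (φ t))
    (Tendsto.const_add (φ s) ?_) (fun k => step (g k) (hag k) (hgc k) (hgi k) (hgt k))
  have hIoc : ∀ r ∈ Set.uIoc s t, r ∈ Set.Icc s t := fun r hr => by
    rw [Set.uIoc_of_le hst] at hr; exact Set.Ioc_subset_Icc_self hr
  refine intervalIntegral.tendsto_integral_filter_of_dominated_convergence
    (fun r => ‖b r * Real.exp (-∫ w in s..r, a w)‖) (Eventually.of_forall fun k => ?_)
    (Eventually.of_forall fun k => ae_of_all _ fun r hr => ?_) ?_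
    (ae_of_all _ fun r hr => (hlim r (hIoc r hr)).const_mul (b r))
  · exact ((hb.mul_continuousOn (hcontP _ (hgi k)) isCompact_Icc).mono_set hIoc).aestronglyMeasurable
  · rw [norm_mul, norm_mul, Real.norm_of_nonneg (Real.exp_pos _).le,
      Real.norm_of_nonneg (Real.exp_pos _).le]
    refine mul_le_mul_of_nonneg_left (Real.exp_le_exp.2 ?_) (norm_nonneg _)
    have := hlo k r (hIoc r hr)
    linarith
  · exact (hii _ (hb.mul_continuousOn (hcontP _ ha) isCompact_Icc) s t le_rfl hst le_rfl).norm

/-! ### The Markov property and the supermartingale inequality -/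

theorem past_mono {Ω : Type*} {n : ℕ} {v : ℝ → Ω → EuclideanSpace ℝ (Fin n)} {s t : ℝ}
    (hst : s ≤ t) : past v s ≤ past v t :=
  biSup_mono fun _ hr => ⟨hr.1, hr.2.trans hst⟩

theorem measurable_past {Ω : Type*} {n : ℕ} {v : ℝ → Ω → EuclideanSpace ℝ (Fin n)} {r t : ℝ}
    (hr : r ∈ Set.Icc (0 : ℝ) t) : Measurable[past v t] (v r) :=
  (comap_measurable (v r)).mono (le_iSup₂_of_le r hr le_rfl) le_rfl

variable {Ω : Type*} [mΩ : MeasurableSpace Ω] {n : ℕ} {μ : Measure Ω} {T : ℝ}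
  {v : ℝ → Ω → EuclideanSpace ℝ (Fin n)} {M : EuclideanSpace ℝ (Fin n) → ℝ → ℝ} {a b : ℝ → ℝ}

theorem IsMarkovProcess.past_le (hv : IsMarkovProcess μ T v) {t : ℝ} (ht : t ≤ T) :
    past v t ≤ mΩ :=
  iSup₂_le fun r hr => (hv.measurable r ⟨hr.1, hr.2.trans ht⟩).comap_le

/-- The Markov property, stated for indicators in the definition, extends to every integrable
function of the state. -/
theorem IsMarkovProcess.condExp_past_ae_eq [IsProbabilityMeasure μ] (hv : IsMarkovProcess μ T v)
    {s t : ℝ} (hs : 0 ≤ s) (hst : s ≤ t) (ht : t ≤ T) {f : EuclideanSpace ℝ (Fin n) → ℝ}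
    (hf : Measurable f) (hfi : Integrable (fun ω => f (v t ω)) μ) :
    μ[fun ω => f (v t ω) | past v s] =ᵐ[μ] μ[fun ω => f (v t ω) | present v s] := by
  have hvt : Measurable (v t) := hv.measurable t ⟨hs.trans hst, ht⟩
  have hpast : past v s ≤ mΩ := hv.past_le (hst.trans ht)
  have hpres : present v s ≤ mΩ := (hv.measurable s ⟨hs, hst.trans ht⟩).comap_le
  have hint : ∀ g : SimpleFunc (EuclideanSpace ℝ (Fin n)) ℝ, Integrable (fun ω => g (v t ω)) μ :=
    fun g => (g.integrable_of_isFiniteMeasure (μ := μ.map (v t))).comp_measurable hvt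
  have hsimple : ∀ g : SimpleFunc (EuclideanSpace ℝ (Fin n)) ℝ,
      μ[fun ω => g (v t ω) | past v s] =ᵐ[μ] μ[fun ω => g (v t ω) | present v s] := by
    intro g
    induction g using SimpleFunc.induction with
    | const c hA =>
      rename_i A
      have e : (fun ω => (SimpleFunc.piecewise A hA (SimpleFunc.const _ c)
          (SimpleFunc.const _ 0)) (v t ω))
          = c • (v t ⁻¹' A).indicator (fun _ => (1 : ℝ)) := by
        ext ω
        by_cases h : v t ω ∈ A <;> simp [h]
      rw [e]
      refine (condExp_smul c _ _).trans (EventuallyEq.trans ?_ (condExp_smul c _ _).symm)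
      exact (hv.markov s t hs hst ht A hA).const_smul c
    | add hdis h1 h2 =>
      rename_i g1 g2
      refine (condExp_add (hint g1) (hint g2) _).trans
        ((h1.add h2).trans (condExp_add (hint g1) (hint g2) _).symm)
  -- Integrable functions of `v t` are dominated limits of simple ones, and both conditional
  -- expectations are continuous in `L¹` along such limits.
  set F : ℕ → SimpleFunc (EuclideanSpace ℝ (Fin n)) ℝ := fun k =>
    SimpleFunc.approxOn f hf Set.univ 0 (Set.mem_univ _) k with hF
  have hbound : ∀ k, ∀ᵐ ω ∂μ, ‖F k (v t ω)‖ ≤ ‖f (v t ω)‖ + ‖f (v t ω)‖ := fun k =>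
    ae_of_all _ fun ω => SimpleFunc.norm_approxOn_zero_le hf (Set.mem_univ _) (v t ω) k
  have hlim : ∀ᵐ ω ∂μ, Tendsto (fun k => F k (v t ω)) atTop (𝓝 (f (v t ω))) :=
    ae_of_all _ fun ω => SimpleFunc.tendsto_approxOn hf (Set.mem_univ _) (by simp)
  have hbi : Integrable (fun ω => ‖f (v t ω)‖ + ‖f (v t ω)‖) μ := hfi.norm.add hfi.norm
  have l1 := tendsto_condExpL1_of_dominated_convergence hpast _
    (fun k => (hint (F k)).1) hbi hbound hlim
  have l2 := tendsto_condExpL1_of_dominated_convergence hpres _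
    (fun k => (hint (F k)).1) hbi hbound hlim
  have heq : ∀ k, condExpL1 hpast μ (fun ω => F k (v t ω))
      = condExpL1 hpres μ (fun ω => F k (v t ω)) := fun k => by
    ext1
    exact (condExp_ae_eq_condExpL1 hpast _).symm.trans
      ((hsimple (F k)).trans (condExp_ae_eq_condExpL1 hpres _))
  simp only [heq] at l1
  refine (condExp_ae_eq_condExpL1 hpast _).trans ?_
  rw [tendsto_nhds_unique l1 l2]
  exact (condExp_ae_eq_condExpL1 hpres _).symm

/-- On an event of the past, the mean of `M(v_r, r)` satisfies the differential inequality
`φ' ≤ a φ + b P(A)` for the right upper Dini derivative. -/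
theorem IsAffineMartingale.setIntegral_rightDini_le [IsProbabilityMeasure μ]
    (hM : IsAffineMartingale μ T v M a b) (hv : IsMarkovProcess μ T v) {u : ℝ}
    (hu : u ∈ Set.Ico (0 : ℝ) T) {A : Set Ω} (hA : MeasurableSet[past v u] A) {c : ℝ}
    (hc : a u * (∫ ω in A, M (v u ω) u ∂μ) + b u * μ.real A < c) :
    ∀ᶠ r in 𝓝[>] u,
      (∫ ω in A, M (v r ω) r ∂μ) - ∫ ω in A, M (v u ω) u ∂μ ≤ c * (r - u) := by
  have hpast : past v u ≤ mΩ := hv.past_le hu.2.le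
  have hu' : u ∈ Set.Icc (0 : ℝ) T := ⟨hu.1, hu.2.le⟩
  have hshift : Tendsto (fun r => r - u) (𝓝[>] u) (𝓝[>] 0) := by
    refine tendsto_nhdsWithin_iff.2 ⟨?_, ?_⟩
    · have : Tendsto (fun r => r - u) (𝓝 u) (𝓝 (u - u)) := (continuous_sub_right u).tendsto u
      rw [sub_self] at this
      exact this.mono_left nhdsWithin_le_nhds
    · filter_upwards [self_mem_nhdsWithin] with r hr using sub_pos.2 (Set.mem_Ioi.1 hr)
  have hd := ((hM.drift_le u hu).comp hshift).eventually
    (gt_mem_nhds (sub_pos.2 hc))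
  filter_upwards [hd, Ioo_mem_nhdsGT hu.2] with r h1 hr
  have hr' : r ∈ Set.Icc (0 : ℝ) T := ⟨hu.1.trans hr.1.le, hr.2.le⟩
  have hh : 0 < r - u := sub_pos.2 hr.1
  simp only [Function.comp_apply, add_sub_cancel] at h1
  have hiu := hM.integrable u hu'
  have hir := hM.integrable r hr'
  have hce : Integrable (μ[fun ω => M (v r ω) r | present v u]) μ := integrable_condExp
  have hφr : ∫ ω in A, M (v r ω) r ∂μ
      = ∫ ω in A, (μ[fun ω => M (v r ω) r | present v u]) ω ∂μ := by
    rw [← setIntegral_condExp hpast hir hA]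
    exact integral_congr_ae (ae_restrict_of_ae
      (hv.condExp_past_ae_eq hu.1 hr.1.le hr.2.le (hM.measurable r hr') hir))
  set D : Ω → ℝ := μ[fun ω => M (v r ω) r | present v u] with hD
  have hXi : Integrable (fun ω => (D ω - M (v u ω) u) / (r - u)) μ := (hce.sub hiu).div_const _
  have hYi : Integrable (fun ω => a u * M (v u ω) u + b u) μ :=
    (hiu.const_mul _).add (integrable_const _)
  have hpos : Integrable
      (fun ω => max ((D ω - M (v u ω) u) / (r - u) - (a u * M (v u ω) u + b u)) 0) μ :=
    (hXi.sub hYi).pos_part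
  have h2 : ∫ ω in A, (D ω - M (v u ω) u) / (r - u) ∂μ
        - ∫ ω in A, (a u * M (v u ω) u + b u) ∂μ
      ≤ ∫ ω, max ((D ω - M (v u ω) u) / (r - u) - (a u * M (v u ω) u + b u)) 0 ∂μ := by
    rw [← integral_sub hXi.integrableOn hYi.integrableOn]
    refine (integral_mono (hXi.sub hYi).integrableOn hpos.integrableOn
      fun ω => le_max_left _ _).trans ?_
    exact setIntegral_le_integral hpos (ae_of_all _ fun ω => le_max_right _ _)
  rw [integral_div, integral_sub hce.integrableOn hiu.integrableOn, ← hφr,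
    integral_add (hiu.const_mul _).integrableOn (integrable_const _).integrableOn,
    integral_const_mul, setIntegral_const, smul_eq_mul, mul_comm (μ.real A)] at h2
  rw [← div_le_iff₀ hh]
  linarith

/-- Almost sure left-continuity at `u` makes the mean over `A` lower semicontinuous from the left,
because `min (M(v_r, r)) (M(v_u, u))` is dominated by `M(v_u, u)`. -/
theorem IsAffineMartingale.eventually_lt_setIntegral [IsProbabilityMeasure μ]
    (hM : IsAffineMartingale μ T v M a b)
    (hreg : IsRegularProcess μ T (fun t ω => M (v t ω) t)) {u : ℝ} (hu : u ∈ Set.Ioc (0 : ℝ) T)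
    (A : Set Ω) {c : ℝ} (hc : c < ∫ ω in A, M (v u ω) u ∂μ) :
    ∀ᶠ r in 𝓝[<] u, c < ∫ ω in A, M (v r ω) r ∂μ := by
  have hu' : u ∈ Set.Icc (0 : ℝ) T := ⟨hu.1.le, hu.2⟩
  have hev : ∀ᶠ r in 𝓝[<] u, r ∈ Set.Icc (0 : ℝ) T := by
    filter_upwards [Ioo_mem_nhdsLT hu.1] with r hr using ⟨hr.1.le, hr.2.le.trans hu.2⟩
  have hlim : Tendsto (fun r => ∫ ω in A, min (M (v r ω) r) (M (v u ω) u) ∂μ) (𝓝[<] u)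
      (𝓝 (∫ ω in A, M (v u ω) u ∂μ)) := by
    refine tendsto_integral_filter_of_dominated_convergence (fun ω => M (v u ω) u) ?_ ?_
      (hM.integrable u hu').integrableOn ?_
    · filter_upwards [hev] with r hr
      exact ((hM.integrable r hr).inf (hM.integrable u hu')).integrableOn.aestronglyMeasurable
    · filter_upwards [hev] with r hr
      refine ae_of_all _ fun ω => ?_
      rw [Real.norm_of_nonneg (le_min (hM.nonneg r hr _) (hM.nonneg u hu' _))]
      exact min_le_right _ _
    · refine ae_restrict_of_ae ?_
      filter_upwards [hreg.left_cont u hu'] with ω hω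
      have h1 : Tendsto (fun r => M (v r ω) r) (𝓝[<] u) (𝓝 (M (v u ω) u)) := by
        refine hω.mono_left ?_
        rw [← nhdsWithin_Ioo_eq_nhdsLT hu.1]
        exact nhdsWithin_mono _ fun r hr => ⟨hr.1.le, hr.2.le⟩
      simpa using h1.min (tendsto_const_nhds (x := M (v u ω) u))
  filter_upwards [hlim.eventually (lt_mem_nhds hc), hev] with r h1 hr
  refine h1.trans_le (integral_mono ?_ (hM.integrable r hr).integrableOn
    fun ω => min_le_left _ _)
  exact ((hM.integrable r hr).inf (hM.integrable u hu')).integrableOn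

theorem IsAffineMartingale.integrable_Mtilde [IsProbabilityMeasure μ]
    (hM : IsAffineMartingale μ T v M a b) {t : ℝ} (ht : t ∈ Set.Icc (0 : ℝ) T) :
    Integrable (fun ω => Mtilde M a b T (v t ω) t) μ :=
  ((hM.integrable t ht).mul_const _).add (integrable_const _)

theorem IsAffineMartingale.setIntegral_Mtilde [IsProbabilityMeasure μ]
    (hM : IsAffineMartingale μ T v M a b) {t : ℝ} (ht : t ∈ Set.Icc (0 : ℝ) T) (A : Set Ω) :
    ∫ ω in A, Mtilde M a b T (v t ω) t ∂μ
      = (∫ ω in A, M (v t ω) t ∂μ) * psi a T t + μ.real A * ∫ τ in t..T, b τ * psi a T τ := by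
  unfold Mtilde
  rw [integral_add ((hM.integrable t ht).mul_const _).integrableOn
    (integrable_const _).integrableOn, integral_mul_const, setIntegral_const, smul_eq_mul]

theorem continuousOn_psi (hT : 0 ≤ T) (ha : IntervalIntegrable a volume 0 T) :
    ContinuousOn (psi a T) (Set.Icc 0 T) := by
  have h := intervalIntegral.continuousOn_primitive_interval_left (μ := volume) (f := a)
    (a := 0) (b := T) ((intervalIntegrable_iff' (by finiteness)).1 ha)
  rw [Set.uIcc_of_le hT] at h
  exact Real.continuous_exp.comp_continuousOn h

theorem intervalIntegrable_mul_psi (hT : 0 ≤ T) (ha : IntervalIntegrable a volume 0 T)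
    (hb : IntervalIntegrable b volume 0 T) :
    IntervalIntegrable (fun τ => b τ * psi a T τ) volume 0 T :=
  hb.mul_continuousOn (by rw [Set.uIcc_of_le hT]; exact continuousOn_psi hT ha)

/-- The process `M̃(v_t, t)` is a supermartingale with respect to the history of `v`. -/
theorem IsAffineMartingale.setIntegral_Mtilde_le [IsProbabilityMeasure μ]
    (hM : IsAffineMartingale μ T v M a b) (hv : IsMarkovProcess μ T v)
    (hreg : IsRegularProcess μ T (fun t ω => M (v t ω) t))
    (ha : IntervalIntegrable a volume 0 T) (hb : IntervalIntegrable b volume 0 T)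
    {s t : ℝ} (hs : 0 ≤ s) (hst : s ≤ t) (ht : t ≤ T) {A : Set Ω}
    (hA : MeasurableSet[past v s] A) :
    ∫ ω in A, Mtilde M a b T (v t ω) t ∂μ ≤ ∫ ω in A, Mtilde M a b T (v s ω) s ∂μ := by
  have hT : 0 ≤ T := (hs.trans hst).trans ht
  have hon : ∀ f : ℝ → ℝ, IntervalIntegrable f volume 0 T → IntegrableOn f (Set.Icc s t) :=
    fun f hf => ((intervalIntegrable_iff_integrableOn_Icc_of_le hT).1 hf).mono_set
      (Set.Icc_subset_Icc hs ht)
  have hii : ∀ f : ℝ → ℝ, IntervalIntegrable f volume 0 T → ∀ x y, 0 ≤ x → x ≤ y → y ≤ T →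
      IntervalIntegrable f volume x y := fun f hf x y hx hxy hy =>
    hf.mono_set (by
      rw [Set.uIcc_of_le hxy, Set.uIcc_of_le hT]; exact Set.Icc_subset_Icc hx hy)
  have key := le_of_rightDini_le_affine (φ := fun r => ∫ ω in A, M (v r ω) r ∂μ) (a := a)
    (b := fun u => b u * μ.real A) hst (hon a ha) ((hon b hb).mul_const _)
    (fun u hu => integral_nonneg fun ω => hM.nonneg u ⟨hs.trans hu.1, hu.2.trans ht⟩ _)
    (fun u hu c hc => hM.setIntegral_rightDini_le hv ⟨hs.trans hu.1, hu.2.trans_le ht⟩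
      (past_mono hu.1 _ hA) hc)
    (fun u hu c hc => hM.eventually_lt_setIntegral hreg ⟨hs.trans_lt hu.1, hu.2.trans ht⟩ A hc)
  have hψ : ∀ r ∈ Set.Icc s t, psi a T s * Real.exp (-∫ w in s..r, a w) = psi a T r := by
    intro r hr
    unfold psi
    rw [← Real.exp_add, ← intervalIntegral.integral_add_adjacent_intervals
      (hii a ha s r hs hr.1 (hr.2.trans ht)) (hii a ha r T (hs.trans hr.1) (hr.2.trans ht) le_rfl)]
    congr 1; ring
  have hψi := intervalIntegrable_mul_psi hT ha hb
  have hint : psi a T s * ∫ u in s..t, b u * μ.real A * Real.exp (-∫ w in s..u, a w)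
      = μ.real A * ∫ u in s..t, b u * psi a T u := by
    rw [← intervalIntegral.integral_const_mul, ← intervalIntegral.integral_const_mul]
    refine intervalIntegral.integral_congr fun u hu => ?_
    rw [Set.uIcc_of_le hst] at hu
    rw [← hψ u hu]
    ring
  rw [hM.setIntegral_Mtilde ⟨hs.trans hst, ht⟩, hM.setIntegral_Mtilde ⟨hs, hst.trans ht⟩,
    ← intervalIntegral.integral_add_adjacent_intervals (hii _ hψi s t hs hst ht)
      (hii _ hψi t T (hs.trans hst) ht le_rfl)]
  have h1 := mul_le_mul_of_nonneg_left key (Real.exp_pos (∫ τ in s..T, a τ)).le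
  change psi a T s * _ ≤ psi a T s * _ at h1
  rw [mul_add, hint, mul_left_comm, hψ t ⟨hst, le_rfl⟩] at h1
  linarith

/-! ### The maximal inequality -/

/-- Although `M̃` may be negative, its means over events of the past are not, because
`M̃(x, T) = M(x, T)`. -/
theorem IsAffineMartingale.setIntegral_Mtilde_nonneg [IsProbabilityMeasure μ]
    (hM : IsAffineMartingale μ T v M a b) (hv : IsMarkovProcess μ T v)
    (hreg : IsRegularProcess μ T (fun t ω => M (v t ω) t))
    (ha : IntervalIntegrable a volume 0 T) (hb : IntervalIntegrable b volume 0 T)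
    {s : ℝ} (hs : s ∈ Set.Icc (0 : ℝ) T) {A : Set Ω} (hA : MeasurableSet[past v s] A) :
    0 ≤ ∫ ω in A, Mtilde M a b T (v s ω) s ∂μ := by
  refine le_trans ?_ (hM.setIntegral_Mtilde_le hv hreg ha hb hs.1 hs.2 le_rfl hA)
  refine integral_nonneg fun ω => ?_
  simpa [Mtilde, psi] using hM.nonneg T ⟨hs.1.trans hs.2, le_rfl⟩ (v T ω)

theorem IsAffineMartingale.measurable_Mtilde (hM : IsAffineMartingale μ T v M a b) {t : ℝ}
    (ht : t ∈ Set.Icc (0 : ℝ) T) : Measurable (fun x => Mtilde M a b T x t) :=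
  ((hM.measurable t ht).mul_const _).add_const _

/-- Doob's maximal inequality for `M̃(v_t, t)` along finitely many times, on an event of the past
of the first one. -/
theorem IsAffineMartingale.mul_measureReal_exists_lt_le [IsProbabilityMeasure μ]
    (hM : IsAffineMartingale μ T v M a b) (hv : IsMarkovProcess μ T v)
    (hreg : IsRegularProcess μ T (fun t ω => M (v t ω) t))
    (ha : IntervalIntegrable a volume 0 T) (hb : IntervalIntegrable b volume 0 T)
    {c : ℝ} (hc : 0 ≤ c) (N : ℕ) {t : ℕ → ℝ} (ht : Monotone t)
    (htT : ∀ k, t k ∈ Set.Icc (0 : ℝ) T) {A : Set Ω} (hA : MeasurableSet[past v (t 0)] A) :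
    c * μ.real (A ∩ {ω | ∃ k < N, c < Mtilde M a b T (v (t k) ω) (t k)})
      ≤ ∫ ω in A, Mtilde M a b T (v (t 0) ω) (t 0) ∂μ := by
  induction N generalizing t A with
  | zero => simpa using hM.setIntegral_Mtilde_nonneg hv hreg ha hb (htT 0) hA
  | succ N ih =>
    set X : ℕ → Ω → ℝ := fun k ω => Mtilde M a b T (v (t k) ω) (t k) with hX
    have hB : MeasurableSet[past v (t 0)] {ω | c < X 0 ω} :=
      ((hM.measurable_Mtilde (htT 0)).comp (measurable_past ⟨(htT 0).1, le_rfl⟩)) measurableSet_Ioi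
    have hpast := hv.past_le (htT 0).2
    have hX0 : Integrable (X 0) μ := hM.integrable_Mtilde (htT 0)
    have h1 : c * μ.real (A ∩ {ω | c < X 0 ω}) ≤ ∫ ω in A ∩ {ω | c < X 0 ω}, X 0 ω ∂μ := by
      have := setIntegral_mono_on (f := fun _ => c) (integrable_const c).integrableOn
        hX0.integrableOn (hpast _ (hA.inter hB)) (fun ω hω => le_of_lt hω.2)
      rwa [setIntegral_const, smul_eq_mul, mul_comm] at this
    have h01 : t 0 ≤ t 1 := ht zero_le_one
    have hdiff : MeasurableSet[past v (t 0)] (A \ {ω | c < X 0 ω}) := hA.diff hB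
    have h2 := (ih (t := fun k => t (k + 1)) (fun i j hij => ht (by omega)) (fun k => htT _)
      (past_mono h01 _ hdiff)).trans
      (hM.setIntegral_Mtilde_le hv hreg ha hb (htT 0).1 h01 (htT 1).2 hdiff)
    have hsub : A ∩ {ω | ∃ k < N + 1, c < X k ω} ⊆ (A ∩ {ω | c < X 0 ω}) ∪
        ((A \ {ω | c < X 0 ω}) ∩ {ω | ∃ k < N, c < X (k + 1) ω}) := by
      rintro ω ⟨hωA, k, hk, hck⟩
      by_cases h : c < X 0 ω
      · exact Or.inl ⟨hωA, h⟩
      · cases k with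
        | zero => exact absurd hck h
        | succ k => exact Or.inr ⟨⟨hωA, h⟩, k, by omega, hck⟩
    calc c * μ.real (A ∩ {ω | ∃ k < N + 1, c < X k ω})
        ≤ c * (μ.real (A ∩ {ω | c < X 0 ω})
          + μ.real ((A \ {ω | c < X 0 ω}) ∩ {ω | ∃ k < N, c < X (k + 1) ω})) :=
          mul_le_mul_of_nonneg_left
            ((measureReal_mono hsub).trans (measureReal_union_le _ _)) hc
      _ ≤ (∫ ω in A ∩ {ω | c < X 0 ω}, X 0 ω ∂μ) + ∫ ω in A \ {ω | c < X 0 ω}, X 0 ω ∂μ := by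
          rw [mul_add]; exact add_le_add h1 h2
      _ = ∫ ω in A, X 0 ω ∂μ := integral_inter_add_sdiff (hpast _ hB) hX0.integrableOn

/-! ### Passage to continuous time -/

/-- The dyadic grid `k T / 2 ^ N` of `[0, T]`, constant equal to `T` from `k = 2 ^ N` on. -/
noncomputable def dyadicTime (T : ℝ) (N k : ℕ) : ℝ := min (k * T / 2 ^ N) T

theorem dyadicTime_mem (hT : 0 ≤ T) (N k : ℕ) : dyadicTime T N k ∈ Set.Icc 0 T :=
  ⟨le_min (by positivity) hT, min_le_right _ _⟩

theorem monotone_dyadicTime (hT : 0 ≤ T) (N : ℕ) : Monotone (dyadicTime T N) := fun i j hij => by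
  unfold dyadicTime
  gcongr

theorem dyadicTime_succ (T : ℝ) (N k : ℕ) : dyadicTime T (N + 1) (2 * k) = dyadicTime T N k := by
  unfold dyadicTime
  congr 1
  rw [pow_succ, div_eq_div_iff (by positivity) (by positivity)]
  push_cast
  ring

/-- Every time in `[0, T]` is approximated from the right by points of the dyadic grids. -/
theorem tendsto_dyadicTime_ceil {t : ℝ} (ht : t ∈ Set.Icc 0 T) :
    Tendsto (fun N => dyadicTime T N ⌈t / T * 2 ^ N⌉₊) atTop (𝓝[Set.Icc t T] t) := by
  have hT : 0 ≤ T := ht.1.trans ht.2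
  -- For `T = 0` the quotient `t / T` is `0`, which is the right value since then `t = 0`.
  have e : t / T * T = t := by
    rcases eq_or_ne T 0 with h | h
    · subst h
      simp [le_antisymm ht.2 ht.1]
    · exact div_mul_cancel₀ t h
  have hlo : ∀ N, t ≤ dyadicTime T N ⌈t / T * 2 ^ N⌉₊ := fun N => by
    refine le_min ?_ ht.2
    rw [le_div_iff₀ (by positivity)]
    calc t * 2 ^ N = t / T * 2 ^ N * T := by rw [mul_right_comm, e]
      _ ≤ _ := mul_le_mul_of_nonneg_right (Nat.le_ceil _) hT
  have hhi : ∀ N, dyadicTime T N ⌈t / T * 2 ^ N⌉₊ ≤ t + T * (1 / 2) ^ N := fun N => by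
    refine (min_le_left _ _).trans ?_
    rw [div_le_iff₀ (by positivity)]
    have h1 : (⌈t / T * 2 ^ N⌉₊ : ℝ) ≤ t / T * 2 ^ N + 1 :=
      (Nat.ceil_lt_add_one (mul_nonneg (div_nonneg ht.1 hT) (by positivity))).le
    calc (⌈t / T * 2 ^ N⌉₊ : ℝ) * T ≤ (t / T * 2 ^ N + 1) * T :=
          mul_le_mul_of_nonneg_right h1 hT
      _ = t / T * T * 2 ^ N + T := by ring
      _ = (t + T * (1 / 2) ^ N) * 2 ^ N := by
          rw [e, add_mul, mul_assoc, ← mul_pow]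
          norm_num
  refine tendsto_nhdsWithin_iff.2 ⟨?_, Eventually.of_forall fun N => ⟨hlo N, min_le_right _ _⟩⟩
  refine tendsto_of_tendsto_of_tendsto_of_le_of_le tendsto_const_nhds ?_ hlo hhi
  simpa using ((tendsto_pow_atTop_nhds_zero_of_lt_one (r := (1 / 2 : ℝ)) (by norm_num)
    (by norm_num)).const_mul T).const_add t

theorem ceil_le_two_pow {t : ℝ} (ht : t ∈ Set.Icc 0 T) (N : ℕ) : ⌈t / T * 2 ^ N⌉₊ ≤ 2 ^ N := by
  refine Nat.ceil_le.2 ?_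
  push_cast
  exact mul_le_of_le_one_left (by positivity) (div_le_one_of_le₀ ht.2 (ht.1.trans ht.2))

theorem continuousWithinAt_Mtilde (hT : 0 ≤ T) (ha : IntervalIntegrable a volume 0 T)
    (hb : IntervalIntegrable b volume 0 T) {x : ℝ → EuclideanSpace ℝ (Fin n)} {t : ℝ}
    (ht : t ∈ Set.Icc (0 : ℝ) T)
    (h : ContinuousWithinAt (fun s => M (x s) s) (Set.Icc t T) t) :
    ContinuousWithinAt (fun s => Mtilde M a b T (x s) s) (Set.Icc t T) t := by
  have hsub : Set.Icc t T ⊆ Set.Icc 0 T := Set.Icc_subset_Icc ht.1 le_rfl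
  have h2 := intervalIntegral.continuousOn_primitive_interval_left (μ := volume)
    ((intervalIntegrable_iff' (by finiteness)).1 (intervalIntegrable_mul_psi hT ha hb))
  rw [Set.uIcc_of_le hT] at h2
  exact (h.mul ((continuousOn_psi hT ha t ht).mono hsub)).add ((h2 t ht).mono hsub)

end CTAffine

theorem lemma1 {Ω : Type*} [MeasurableSpace Ω] (μ : Measure Ω) [IsProbabilityMeasure μ]
    {n : ℕ} (T : ℝ) (hT : 0 ≤ T) (v : ℝ → Ω → EuclideanSpace ℝ (Fin n))
    (M : EuclideanSpace ℝ (Fin n) → ℝ → ℝ) (a b : ℝ → ℝ)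
    (ha : IntervalIntegrable a volume 0 T) (hb : IntervalIntegrable b volume 0 T)
    (hv : CTAffine.IsMarkovProcess μ T v)
    (hreg : CTAffine.IsRegularProcess μ T (fun t ω => M (v t ω) t))
    (hM : CTAffine.IsAffineMartingale μ T v M a b)
    (Mbar : ℝ) (hMbar : 0 < Mbar) :
    NullMeasurableSet
        {ω | ∀ t ∈ Set.Icc (0 : ℝ) T, v t ω ∈ CTAffine.sublevel M a b T Mbar t} μ ∧
      1 - ((∫ ω, M (v 0 ω) 0 ∂μ) * CTAffine.psi a T 0
            + ∫ τ in (0 : ℝ)..T, b τ * CTAffine.psi a T τ) / Mbar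
        ≤ μ.real {ω | ∀ t ∈ Set.Icc (0 : ℝ) T, v t ω ∈ CTAffine.sublevel M a b T Mbar t} := by
  set X : ℝ → Ω → ℝ := fun t ω => CTAffine.Mtilde M a b T (v t ω) t with hX
  set G : Set Ω := {ω | ∀ t ∈ Set.Icc (0 : ℝ) T, v t ω ∈ CTAffine.sublevel M a b T Mbar t} with hG
  set E : ℕ → Set Ω := fun N =>
    {ω | ∃ k < 2 ^ N + 1, Mbar < X (CTAffine.dyadicTime T N k) ω} with hE
  have hmem := CTAffine.dyadicTime_mem hT
  have hEmeas : ∀ N, MeasurableSet (E N) := fun N => by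
    have : E N = ⋃ k ∈ Set.Iio (2 ^ N + 1), {ω | Mbar < X (CTAffine.dyadicTime T N k) ω} := by
      ext ω; simp [hE]
    rw [this]
    exact MeasurableSet.biUnion (Set.to_countable _) fun k _ =>
      ((hM.measurable_Mtilde (hmem N k)).comp (hv.measurable _ (hmem N k))) measurableSet_Ioi
  have hEmono : Monotone E := monotone_nat_of_le_succ fun N => by
    rintro ω ⟨k, hk, hkX⟩
    exact ⟨2 * k, by rw [pow_succ]; omega, by rwa [CTAffine.dyadicTime_succ]⟩
  -- By right-continuity, leaving the sublevel set at all is leaving it at a dyadic time.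
  have hGE : G =ᵐ[μ] ((⋃ N, E N)ᶜ : Set Ω) := by
    filter_upwards [hreg.right_cont] with ω hω
    refine propext ⟨fun h => ?_, fun h t ht => ?_⟩
    · rintro ⟨_, ⟨N, rfl⟩, k, -, hkX⟩
      exact absurd (h _ (hmem N k)) (not_le.2 hkX)
    · by_contra hlt
      have hcont := CTAffine.continuousWithinAt_Mtilde (x := fun s => v s ω) hT ha hb ht (hω t ht)
      obtain ⟨N, hN⟩ := ((hcont.tendsto.comp (CTAffine.tendsto_dyadicTime_ceil ht)).eventually
        (lt_mem_nhds (not_le.1 hlt))).exists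
      exact h (Set.mem_iUnion.2
        ⟨N, _, Nat.lt_succ_of_le (CTAffine.ceil_le_two_pow ht N), hN⟩)
  have hUmeas : MeasurableSet (⋃ N, E N) := MeasurableSet.iUnion hEmeas
  refine ⟨hUmeas.compl.nullMeasurableSet.congr hGE.symm, ?_⟩
  have hX0 : ∫ ω, X 0 ω ∂μ = (∫ ω, M (v 0 ω) 0 ∂μ) * CTAffine.psi a T 0
      + ∫ τ in (0 : ℝ)..T, b τ * CTAffine.psi a T τ := by
    simpa using hM.setIntegral_Mtilde ⟨le_rfl, hT⟩ Set.univ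
  have hEle : ∀ N, μ.real (E N) ≤ (∫ ω, X 0 ω ∂μ) / Mbar := fun N => by
    rw [le_div_iff₀ hMbar, mul_comm]
    have h := hM.mul_measureReal_exists_lt_le hv hreg ha hb hMbar.le (2 ^ N + 1)
      (CTAffine.monotone_dyadicTime hT N) (hmem N) MeasurableSet.univ
    have h0 : CTAffine.dyadicTime T N 0 = 0 := by simp [CTAffine.dyadicTime, hT]
    rw [h0, Set.univ_inter, setIntegral_univ] at h
    exact h
  have hUle : μ.real (⋃ N, E N) ≤ (∫ ω, X 0 ω ∂μ) / Mbar :=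
    le_of_tendsto' ((ENNReal.tendsto_toReal (measure_ne_top μ _)).comp
      (tendsto_measure_iUnion_atTop hEmono)) hEle
  rw [← hX0, measureReal_congr hGE, probReal_compl_eq_one_sub hUmeas]
  linarith
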